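/- Let $T$ be a commutative domain, let $n\ge 2$, let $q\in T^{\times}$ be a primitive $n$-th root of unity, and let $a\in T$. Let $$A_q=T\langle x,y\rangle/(yx-qxy-a)$$ be the $q$-quantum Weyl algebra over $T$, with center $Z=Z(A_q)$. Then $Z$ is the polynomial ring $T[x^n,y^n]$ in the two elements $x^n,y^n$, and $A_q$ is a free $Z$-module of rank $n^2$ with basis $\{x^iy^j \mid 0\le i,j\le n-1\}$. For $s\in A_q$ let $\operatorname{tr}(s)\in Z$ be the trace of the $Z$-linear map $A_q\to A_q$, $b\mapsto sb$, and for a finite $Z$-basis $z_1,\dots,z_r$ of $A_q$ let $d(A_q/Z)=\det\big(\operatorname{tr}(z_iz_j)\big)_{1\le i,j\le r}\in Z$ be the discriminant of $A_q$ over $Z$ computed in that basis. Then, for every finite $Z$-basis of $A_q$, there is a unit $c\in T^{\times}$ with $$d(A_q/Z)=c\,(nm)^{n^2}\big((1-q)^n x^n y^n-a^n\big)^{n(n-1)},\qquad m=\prod_{i=2}^{n-1}\big(1+q+\cdots+q^{i-1}\big),$$ where $m=1$ if $n=2$. -/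

import Mathlib

universe u v w

/-- The single defining relation `y x = q x y + a` of the `q`-quantum Weyl algebra, on the free
`T`-algebra on two generators (`0` is `x`, `1` is `y`). -/
inductive QWeylRel (T : Type u) [CommRing T] (q a : T) :
    FreeAlgebra T (Fin 2) → FreeAlgebra T (Fin 2) → Prop
  | comm : QWeylRel T q a
      (FreeAlgebra.ι T 1 * FreeAlgebra.ι T 0)
      (q • (FreeAlgebra.ι T 0 * FreeAlgebra.ι T 1) + algebraMap T (FreeAlgebra T (Fin 2)) a)

/-- The `q`-quantum Weyl algebra `T⟨x, y⟩ / (y x - q x y - a)`. -/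
abbrev QWeyl (T : Type u) [CommRing T] (q a : T) : Type u :=
  RingQuot (QWeylRel T q a)

/-- The generator `x` of the `q`-quantum Weyl algebra. -/
noncomputable def QWeyl.x {T : Type u} [CommRing T] (q a : T) : QWeyl T q a :=
  RingQuot.mkAlgHom T (QWeylRel T q a) (FreeAlgebra.ι T 0)

/-- The generator `y` of the `q`-quantum Weyl algebra. -/
noncomputable def QWeyl.y {T : Type u} [CommRing T] (q a : T) : QWeyl T q a :=
  RingQuot.mkAlgHom T (QWeylRel T q a) (FreeAlgebra.ι T 1)

/-- The center of the `q`-quantum Weyl algebra, as a `T`-subalgebra. -/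
abbrev QWeyl.center {T : Type u} [CommRing T] (q a : T) : Subalgebra T (QWeyl T q a) :=
  Subalgebra.center T (QWeyl T q a)

/-- An algebra is an algebra over its center, through the inclusion of the center. The scalar
multiplication is Mathlib's: `z • a = (z : A) * a`. -/
instance centerAlgebra (T : Type u) (A : Type v) [CommRing T] [Ring A] [Algebra T A] :
    Algebra (Subalgebra.center T A) A where
  algebraMap := (Subalgebra.center T A).val.toRingHom
  commutes' z a := (Subalgebra.mem_center_iff.1 z.2 a).symm
  smul_def' _ _ := rfl

/-- The trace `A → End_Z(A) → Z` of a (possibly noncommutative) `Z`-algebra `A`: the trace of the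
left multiplication by an element. -/
noncomputable def leftTrace (Z : Type u) {A : Type v} [CommRing Z] [Ring A] [Algebra Z A]
    (s : A) : Z :=
  LinearMap.trace Z A (LinearMap.mulLeft Z s)

/-- The discriminant `det (tr (zᵢ zⱼ))` of a (possibly noncommutative) `Z`-algebra `A` computed in
a finite `Z`-basis `z` of `A`. -/
noncomputable def basisDiscr (Z : Type u) (A : Type v) [CommRing Z] [Ring A] [Algebra Z A]
    {ι : Type w} [Fintype ι] [DecidableEq ι] (z : Module.Basis ι Z A) : Z :=
  (Matrix.of fun i j => leftTrace Z (z i * z j)).det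

/-!
Write `w = (q - 1) x y + a = y x - x y`. This element is normal: `w x = q x w` and `y w = q w y`.

*Center and freeness.* An explicit representation on the free module on `ℕ × ℕ` shows that the
ordered monomials `x ^ i * y ^ j` form a `T`-basis (`QWeyl.pbwBasis`). The elements `x ^ n` and
`y ^ n` are central because the `q`-integer `1 + q + ⋯ + q ^ (n - 1)` vanishes. Conversely, the
commutators of `z = ∑ c i j • x ^ i * y ^ j` with `y` and `x` express `[i] c i j` and `[j] c i j`,
where `[i] = 1 + q + ⋯ + q ^ (i - 1)`, through the coefficients at `(i + 1, j + 1)`; by finiteness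
of the support both vanish for central `z`, so only exponents divisible by `n` occur
(`IsPBWBasis.dvd_of_mem_center`). Hence the center is `T[x ^ n, y ^ n]`, and division with
remainder of the exponents gives the basis over it.

*Discriminant.* The trace form is easy on the monomials `x ^ i * w ^ j`: since `x` and `w` commute
up to `q` and `tr (s t) = tr (t s)`, their trace is zero unless `n` divides `i` and `j`
(`leftTrace_pow_mul_normalElt_pow`). So for `0 ≤ i, j < n` their Gram matrix is a monomial matrix,
with determinant a unit times `n ^ (2 n ^ 2) (X W) ^ (n (n - 1))`, where `X = x ^ n` and
`W = w ^ n`. Passing to the basis `x ^ i * y ^ j` divides this by the square of the transition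
determinant, which is a unit times `(1 - q) ^ ((n - 1) n ^ 2) X ^ (n (n - 1))`
(`det_gramMatrix_normal_eq`). It remains to note that `n = (1 - q) ^ (n - 1) m`, that
`W = -((1 - q) ^ n x ^ n y ^ n - a ^ n)` (`IsPBWBasis.normalElt_pow_order`), and that a change of
basis over the center multiplies the discriminant by the square of a unit of a polynomial ring
over a domain, which is a unit of `T`.
-/

/-! ### Relations in the quantum Weyl algebra -/

section Relations

variable {T : Type*} [CommRing T] {A : Type*} [Ring A] [Algebra T A] {q a : T} {x y : A}

theorem y_mul_x_pow (h : y * x = q • (x * y) + algebraMap T A a) (i : ℕ) :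
    y * x ^ i = q ^ i • (x ^ i * y) + ((∑ k ∈ Finset.range i, q ^ k) * a) • x ^ (i - 1) := by
  induction i with
  | zero => simp
  | succ i ih =>
    have hx : ((∑ k ∈ Finset.range i, q ^ k) * a) • x ^ (i - 1) * x =
        ((∑ k ∈ Finset.range i, q ^ k) * a) • x ^ i := by
      cases i with
      | zero => simp
      | succ i => simp [pow_succ]
    have e : x ^ i * y * x = q • (x ^ (i + 1) * y) + a • x ^ i := by
      rw [mul_assoc, h, mul_add, mul_smul_comm, ← mul_assoc, ← pow_succ, ← Algebra.commutes,
        ← Algebra.smul_def]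
    rw [pow_succ, ← mul_assoc, ih, add_mul, hx, smul_mul_assoc, e, ← pow_succ,
      Finset.sum_range_succ, Nat.add_sub_cancel]
    module

theorem y_pow_mul_x (h : y * x = q • (x * y) + algebraMap T A a) (j : ℕ) :
    y ^ j * x = q ^ j • (x * y ^ j) + ((∑ k ∈ Finset.range j, q ^ k) * a) • y ^ (j - 1) := by
  induction j with
  | zero => simp
  | succ j ih =>
    have hy : y * ((∑ k ∈ Finset.range j, q ^ k) * a) • y ^ (j - 1) =
        ((∑ k ∈ Finset.range j, q ^ k) * a) • y ^ j := by
      cases j with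
      | zero => simp
      | succ j => simp [pow_succ']
    have e : y * (x * y ^ j) = q • (x * y ^ (j + 1)) + a • y ^ j := by
      rw [← mul_assoc, h, add_mul, smul_mul_assoc, mul_assoc, ← pow_succ', ← Algebra.smul_def]
    rw [pow_succ', mul_assoc, ih, mul_add, hy, mul_smul_comm, e, ← pow_succ',
      Finset.sum_range_succ, Nat.add_sub_cancel]
    module

/-- The element `(q - 1) x y + a`. Under the relation `y x = q x y + a` it is the commutator
`y x - x y`, and it is normal: it commutes with `x` and `y` up to powers of `q`. -/
def normalElt (q a : T) (x y : A) : A := (q - 1) • (x * y) + algebraMap T A a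

theorem normalElt_mul_x (h : y * x = q • (x * y) + algebraMap T A a) :
    normalElt q a x y * x = q • (x * normalElt q a x y) := by
  simp only [normalElt, add_mul, mul_add, smul_mul_assoc, mul_assoc, h,
    Algebra.algebraMap_eq_smul_one]
  simp only [mul_smul_comm, smul_add, smul_smul, mul_one, one_mul]
  module

theorem y_mul_normalElt (h : y * x = q • (x * y) + algebraMap T A a) :
    y * normalElt q a x y = q • (normalElt q a x y * y) := by
  simp only [normalElt, add_mul, mul_add, smul_mul_assoc, mul_smul_comm, ← mul_assoc, h,
    Algebra.algebraMap_eq_smul_one]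
  simp only [smul_add, smul_smul, mul_one, one_mul]
  module

theorem pow_mul_pow_of_mul_eq_smul {z t : A} (h : z * t = q • (t * z)) (i j : ℕ) :
    z ^ i * t ^ j = q ^ (i * j) • (t ^ j * z ^ i) := by
  have h1 (j : ℕ) : z * t ^ j = q ^ j • (t ^ j * z) := by
    induction j with
    | zero => simp
    | succ j ih =>
      rw [pow_succ, ← mul_assoc, ih, smul_mul_assoc, mul_assoc, h, mul_smul_comm, smul_smul,
        pow_succ, mul_assoc]
  induction i with
  | zero => simp
  | succ i ih =>
    rw [pow_succ, mul_assoc, h1, mul_smul_comm, ← mul_assoc, ih, smul_mul_assoc, smul_smul,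
      mul_assoc, ← pow_add]
    congr 2; ring

/-- The coefficient of `x ^ l * y ^ l` in the `j`-th power of `normalElt q a x y`. -/
def normalCoeff (q a : T) : ℕ → ℕ → T
  | 0, 0 => 1
  | 0, _ + 1 => 0
  | j + 1, 0 => a * normalCoeff q a j 0
  | j + 1, l + 1 => q ^ (l + 1) * a * normalCoeff q a j (l + 1) +
      q ^ l * (q - 1) * normalCoeff q a j l

theorem normalCoeff_of_lt (q a : T) {j l : ℕ} (h : j < l) : normalCoeff q a j l = 0 := by
  induction j generalizing l with
  | zero =>
    obtain ⟨l, rfl⟩ : ∃ k, l = k + 1 := ⟨l - 1, by omega⟩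
    rfl
  | succ j ih =>
    obtain ⟨l, rfl⟩ : ∃ k, l = k + 1 := ⟨l - 1, by omega⟩
    rw [normalCoeff, ih (by omega), ih (by omega)]
    simp

theorem normalCoeff_zero_right (q a : T) (j : ℕ) : normalCoeff q a j 0 = a ^ j := by
  induction j with
  | zero => simp [normalCoeff]
  | succ j ih => rw [normalCoeff, ih, pow_succ']

theorem normalCoeff_self (q a : T) (j : ℕ) :
    normalCoeff q a j j = q ^ (∑ k ∈ Finset.range j, k) * (q - 1) ^ j := by
  induction j with
  | zero => simp [normalCoeff]
  | succ j ih =>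
    rw [normalCoeff, ih, normalCoeff_of_lt q a (Nat.lt_succ_self j), Finset.sum_range_succ]
    ring

theorem normalElt_pow (h : y * x = q • (x * y) + algebraMap T A a) (j : ℕ) :
    normalElt q a x y ^ j =
      ∑ l ∈ Finset.range (j + 1), normalCoeff q a j l • (x ^ l * y ^ l) := by
  have key (l : ℕ) : normalElt q a x y * (x ^ l * y ^ l) =
      (q ^ l * a) • (x ^ l * y ^ l) + (q ^ l * (q - 1)) • (x ^ (l + 1) * y ^ (l + 1)) := by
    have := pow_mul_pow_of_mul_eq_smul (normalElt_mul_x h) 1 l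
    rw [pow_one, one_mul] at this
    rw [← mul_assoc, this, smul_mul_assoc, mul_assoc, normalElt, add_mul, mul_add,
      ← Algebra.smul_def, smul_mul_assoc, mul_smul_comm, mul_smul_comm, smul_add, smul_smul,
      smul_smul, add_comm]
    simp only [pow_succ x, pow_succ' y, mul_assoc]
  induction j with
  | zero => simp [normalCoeff]
  | succ j ih =>
    rw [pow_succ', ih, Finset.mul_sum, Finset.sum_range_succ' _ (j + 1)]
    simp only [mul_smul_comm, key, smul_add, smul_smul, Finset.sum_add_distrib]
    have h0 : ∑ l ∈ Finset.range (j + 1), (normalCoeff q a j l * (q ^ l * a)) • (x ^ l * y ^ l) =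
        ∑ l ∈ Finset.range (j + 1),
          (normalCoeff q a j (l + 1) * (q ^ (l + 1) * a)) • (x ^ (l + 1) * y ^ (l + 1)) +
        (normalCoeff q a j 0 * (q ^ 0 * a)) • (x ^ 0 * y ^ 0) := by
      rw [← Finset.sum_range_succ'
        (fun l ↦ (normalCoeff q a j l * (q ^ l * a)) • (x ^ l * y ^ l)),
        Finset.sum_range_succ _ (j + 1), normalCoeff_of_lt q a (Nat.lt_succ_self j)]
      simp
    rw [h0, add_right_comm, ← Finset.sum_add_distrib]
    congr 1
    · refine Finset.sum_congr rfl fun l _ ↦ ?_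
      rw [← add_smul, normalCoeff]
      congr 1; ring
    · rw [normalCoeff]; congr 1; ring

end Relations

/-! ### The Poincaré–Birkhoff–Witt basis -/

section PBW

variable {T : Type u} [CommRing T]

/-- Multiplication by `x` on the free module with basis the monomials `x ^ i * y ^ j`. -/
noncomputable def pbwX (T : Type u) [CommRing T] : Module.End T (ℕ × ℕ →₀ T) :=
  Finsupp.lift _ T _ fun p ↦ Finsupp.single (p.1 + 1, p.2) 1

/-- Multiplication by `y` on the free module with basis the monomials `x ^ i * y ^ j`. For `i = 0`
the truncated subtraction is harmless, its coefficient being an empty sum. -/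
noncomputable def pbwY (q a : T) : Module.End T (ℕ × ℕ →₀ T) :=
  Finsupp.lift _ T _ fun p ↦ Finsupp.single (p.1, p.2 + 1) (q ^ p.1) +
    Finsupp.single (p.1 - 1, p.2) ((∑ k ∈ Finset.range p.1, q ^ k) * a)

theorem pbwX_single (p : ℕ × ℕ) (c : T) :
    pbwX T (Finsupp.single p c) = Finsupp.single (p.1 + 1, p.2) c := by
  simp [pbwX]

theorem pbwY_single (q a : T) (p : ℕ × ℕ) (c : T) :
    pbwY q a (Finsupp.single p c) = Finsupp.single (p.1, p.2 + 1) (c * q ^ p.1) +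
      Finsupp.single (p.1 - 1, p.2) (c * ((∑ k ∈ Finset.range p.1, q ^ k) * a)) := by
  rw [pbwY, Finsupp.lift_apply, Finsupp.sum_single_index, smul_add, Finsupp.smul_single,
    Finsupp.smul_single, smul_eq_mul, smul_eq_mul]
  exact zero_smul T _

theorem pbwY_mul_pbwX (q a : T) :
    pbwY q a * pbwX T = q • (pbwX T * pbwY q a) + algebraMap T _ a := by
  refine Finsupp.lhom_ext fun p c ↦ ?_
  obtain ⟨i, j⟩ := p
  have h : Finsupp.single (i - 1 + 1, j) (q * (c * ((∑ k ∈ Finset.range i, q ^ k) * a))) =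
      Finsupp.single (i, j) (q * (c * ((∑ k ∈ Finset.range i, q ^ k) * a))) := by
    cases i <;> simp
  simp only [Module.End.mul_apply, pbwX_single, pbwY_single, LinearMap.add_apply,
    LinearMap.smul_apply, map_add, smul_add, Finsupp.smul_single, smul_eq_mul, h,
    Module.algebraMap_end_apply, Nat.add_sub_cancel]
  rw [add_assoc, ← Finsupp.single_add, geom_sum_succ]
  congr 2 <;> ring

namespace QWeyl

variable (q a : T)

theorem y_mul_x : y q a * x q a = q • (x q a * y q a) + algebraMap T _ a := by
  have h := RingQuot.mkAlgHom_rel T (QWeylRel.comm (T := T) (q := q) (a := a))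
  simp only [map_mul, map_add, map_smul, AlgHom.commutes] at h
  exact h

/-- The action of the `q`-quantum Weyl algebra on the free module with basis the monomials. -/
noncomputable def pbwRep : QWeyl T q a →ₐ[T] Module.End T (ℕ × ℕ →₀ T) :=
  RingQuot.liftAlgHom T ⟨FreeAlgebra.lift T ![pbwX T, pbwY q a], by
    rintro _ _ ⟨⟩
    simpa using pbwY_mul_pbwX q a⟩

theorem pbwRep_x : pbwRep q a (x q a) = pbwX T := by
  simp [pbwRep, x]

theorem pbwRep_y : pbwRep q a (y q a) = pbwY q a := by
  simp [pbwRep, y]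

theorem pbwRep_monomial (i j : ℕ) :
    pbwRep q a (x q a ^ i * y q a ^ j) (Finsupp.single (0, 0) 1) = Finsupp.single (i, j) 1 := by
  have hy : (pbwY q a ^ j) (Finsupp.single (0, 0) 1) = Finsupp.single (0, j) 1 := by
    induction j with
    | zero => simp
    | succ j ih => rw [pow_succ', Module.End.mul_apply, ih, pbwY_single]; simp
  have hx : (pbwX T ^ i) (Finsupp.single (0, j) 1) = Finsupp.single (i, j) 1 := by
    induction i with
    | zero => simp
    | succ i ih => rw [pow_succ', Module.End.mul_apply, ih, pbwX_single]
  rw [map_mul, map_pow, map_pow, pbwRep_x, pbwRep_y, Module.End.mul_apply, hy, hx]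

theorem linearIndependent_monomials :
    LinearIndependent T fun p : ℕ × ℕ ↦ x q a ^ p.1 * y q a ^ p.2 := by
  let f : QWeyl T q a →ₗ[T] (ℕ × ℕ →₀ T) :=
    (LinearMap.applyₗ (Finsupp.single (0, 0) 1)).comp (pbwRep q a).toLinearMap
  refine LinearIndependent.of_comp f ?_
  have : f ∘ (fun p : ℕ × ℕ ↦ x q a ^ p.1 * y q a ^ p.2) = Finsupp.basisSingleOne (R := T) := by
    funext p
    simpa [f] using pbwRep_monomial q a p.1 p.2
  rw [this]
  exact Finsupp.basisSingleOne.linearIndependent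

theorem adjoin_x_y : Algebra.adjoin T {x q a, y q a} = ⊤ := by
  have h : Set.range (RingQuot.mkAlgHom T (QWeylRel T q a) ∘ FreeAlgebra.ι T) =
      {x q a, y q a} := by
    ext z
    simp [Fin.exists_fin_two, x, y, eq_comm]
  rw [← h, Set.range_comp, ← AlgHom.map_adjoin, FreeAlgebra.adjoin_range_ι, Algebra.map_top]
  exact (AlgHom.range_eq_top _).2 (RingQuot.mkAlgHom_surjective T _)

theorem span_monomials :
    ⊤ ≤ Submodule.span T (Set.range fun p : ℕ × ℕ ↦ x q a ^ p.1 * y q a ^ p.2) := by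
  set S := Submodule.span T (Set.range fun p : ℕ × ℕ ↦ x q a ^ p.1 * y q a ^ p.2) with hS
  have mem (i j : ℕ) : x q a ^ i * y q a ^ j ∈ S := Submodule.subset_span ⟨(i, j), rfl⟩
  -- the span is a left ideal containing `1`
  have hx (s) (hs : s ∈ S) : x q a * s ∈ S := by
    induction hs using Submodule.span_induction with
    | mem s hs =>
      obtain ⟨p, rfl⟩ := hs
      rw [← mul_assoc, ← pow_succ']
      exact mem _ _
    | zero => simp
    | add s t _ _ hs ht => rw [mul_add]; exact S.add_mem hs ht
    | smul c s _ hs => rw [mul_smul_comm]; exact S.smul_mem _ hs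
  have hy (s) (hs : s ∈ S) : y q a * s ∈ S := by
    induction hs using Submodule.span_induction with
    | mem s hs =>
      obtain ⟨p, rfl⟩ := hs
      rw [← mul_assoc, y_mul_x_pow (y_mul_x q a), add_mul, smul_mul_assoc, smul_mul_assoc,
        mul_assoc, ← pow_succ']
      exact S.add_mem (S.smul_mem _ (mem _ _)) (S.smul_mem _ (mem _ _))
    | zero => simp
    | add s t _ _ hs ht => rw [mul_add]; exact S.add_mem hs ht
    | smul c s _ hs => rw [mul_smul_comm]; exact S.smul_mem _ hs
  have hmul (z : QWeyl T q a) (hz : z ∈ Algebra.adjoin T {x q a, y q a}) :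
      ∀ s ∈ S, z * s ∈ S := by
    induction hz using Algebra.adjoin_induction with
    | mem z hz =>
      rcases hz with rfl | rfl
      exacts [hx, hy]
    | algebraMap c => intro s hs; rw [← Algebra.smul_def]; exact S.smul_mem _ hs
    | add z t _ _ hz ht => intro s hs; rw [add_mul]; exact S.add_mem (hz s hs) (ht s hs)
    | mul z t _ _ hz ht => intro s hs; rw [mul_assoc]; exact hz _ (ht s hs)
  intro z _
  have h1 : (1 : QWeyl T q a) ∈ S := by simpa using mem 0 0
  simpa using hmul z (by rw [adjoin_x_y]; trivial) 1 h1

/-- The Poincaré–Birkhoff–Witt basis `x ^ i * y ^ j` of the `q`-quantum Weyl algebra over `T`. -/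
noncomputable def pbwBasis : Module.Basis (ℕ × ℕ) T (QWeyl T q a) :=
  Module.Basis.mk (linearIndependent_monomials q a) (span_monomials q a)

theorem pbwBasis_apply (p : ℕ × ℕ) : pbwBasis q a p = x q a ^ p.1 * y q a ^ p.2 :=
  Module.Basis.mk_apply _ _ _

end QWeyl

end PBW

/-! ### The center and freeness over it -/

section Center

variable {T : Type*} [CommRing T] {A : Type*} [Ring A] [Algebra T A] {q a : T} {x y : A}
  {B : Module.Basis (ℕ × ℕ) T A} {n : ℕ}

/-- The elements `x` and `y` satisfy the relation of the `q`-quantum Weyl algebra and their ordered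
monomials form the basis `B`. This determines the algebra; working with it instead of the
quotient of the free algebra keeps the latter opaque. -/
structure IsPBWBasis (q a : T) (x y : A) (B : Module.Basis (ℕ × ℕ) T A) : Prop where
  y_mul_x : y * x = q • (x * y) + algebraMap T A a
  basis_apply (p : ℕ × ℕ) : B p = x ^ p.1 * y ^ p.2

theorem IsPBWBasis.mem_center (H : IsPBWBasis q a x y B) {z : A} (hx : Commute z x)
    (hy : Commute z y) : z ∈ Subalgebra.center T A := by
  have h : LinearMap.mulRight T z = LinearMap.mulLeft T z := by
    refine B.ext fun p ↦ ?_
    rw [H.basis_apply, LinearMap.mulRight_apply, LinearMap.mulLeft_apply]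
    exact ((hx.pow_right _).mul_right (hy.pow_right _)).eq.symm
  exact Subalgebra.mem_center_iff.2 fun b ↦ LinearMap.congr_fun h b

theorem IsPBWBasis.repr_commutator_y (H : IsPBWBasis q a x y B) (z : A) (i j : ℕ) :
    B.repr (y * z - z * y) (i, j + 1) = (q ^ i - 1) * B.repr z (i, j) +
      ((∑ k ∈ Finset.range (i + 1), q ^ k) * a) * B.repr z (i + 1, j + 1) := by
  have h : B.coord (i, j + 1) ∘ₗ (LinearMap.mulLeft T y - LinearMap.mulRight T y) =
      (q ^ i - 1) • B.coord (i, j) +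
        ((∑ k ∈ Finset.range (i + 1), q ^ k) * a) • B.coord (i + 1, j + 1) := by
    refine B.ext fun p ↦ ?_
    obtain ⟨k, l⟩ := p
    have e : y * B (k, l) - B (k, l) * y = (q ^ k - 1) • B (k, l + 1) +
        ((∑ m ∈ Finset.range k, q ^ m) * a) • B (k - 1, l) := by
      simp only [H.basis_apply]
      rw [← mul_assoc, y_mul_x_pow H.y_mul_x, add_mul, smul_mul_assoc, mul_assoc, mul_assoc,
        ← pow_succ, ← pow_succ', smul_mul_assoc]
      module
    simp only [LinearMap.comp_apply, LinearMap.sub_apply, LinearMap.mulLeft_apply,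
      LinearMap.mulRight_apply, e, map_add, map_smul, LinearMap.add_apply, LinearMap.smul_apply,
      Module.Basis.coord_apply, Module.Basis.repr_self, Finsupp.single_apply, Prod.mk.injEq,
      smul_eq_mul, add_left_inj]
    cases k with
    | zero =>
      by_cases h1 : 0 = i ∧ l = j
      · obtain ⟨rfl, rfl⟩ := h1
        simp
      · simp [h1]
    | succ k =>
      simp only [Nat.add_sub_cancel, add_left_inj]
      congr 1
      · split_ifs with h1
        · rw [h1.1]
        · simp
      · split_ifs with h1
        · rw [h1.1]
        · simp
  simpa using LinearMap.congr_fun h z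

theorem IsPBWBasis.repr_commutator_x (H : IsPBWBasis q a x y B) (z : A) (i j : ℕ) :
    B.repr (z * x - x * z) (i + 1, j) = (q ^ j - 1) * B.repr z (i, j) +
      ((∑ k ∈ Finset.range (j + 1), q ^ k) * a) * B.repr z (i + 1, j + 1) := by
  have h : B.coord (i + 1, j) ∘ₗ (LinearMap.mulRight T x - LinearMap.mulLeft T x) =
      (q ^ j - 1) • B.coord (i, j) +
        ((∑ k ∈ Finset.range (j + 1), q ^ k) * a) • B.coord (i + 1, j + 1) := by
    refine B.ext fun p ↦ ?_
    obtain ⟨k, l⟩ := p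
    have e : B (k, l) * x - x * B (k, l) = (q ^ l - 1) • B (k + 1, l) +
        ((∑ m ∈ Finset.range l, q ^ m) * a) • B (k, l - 1) := by
      simp only [H.basis_apply]
      rw [mul_assoc, y_pow_mul_x H.y_mul_x, mul_add, mul_smul_comm, ← mul_assoc, ← mul_assoc,
        ← pow_succ, ← pow_succ', mul_smul_comm]
      module
    simp only [LinearMap.comp_apply, LinearMap.sub_apply, LinearMap.mulLeft_apply,
      LinearMap.mulRight_apply, e, map_add, map_smul, LinearMap.add_apply, LinearMap.smul_apply,
      Module.Basis.coord_apply, Module.Basis.repr_self, Finsupp.single_apply, Prod.mk.injEq,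
      smul_eq_mul, add_left_inj]
    cases l with
    | zero =>
      by_cases h1 : k = i ∧ 0 = j
      · obtain ⟨rfl, rfl⟩ := h1
        simp
      · simp [h1]
    | succ l =>
      simp only [Nat.add_sub_cancel, add_left_inj]
      congr 1
      · split_ifs with h1
        · rw [h1.2]
        · simp
      · split_ifs with h1
        · rw [h1.2]
        · simp
  simpa using LinearMap.congr_fun h z

theorem IsPrimitiveRoot.dvd_of_geom_sum_eq_zero (hq : IsPrimitiveRoot q n) {i : ℕ}
    (h : ∑ k ∈ Finset.range i, q ^ k = 0) : n ∣ i := by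
  refine hq.dvd_of_pow_eq_one i (sub_eq_zero.1 ?_)
  rw [← mul_geom_sum, h, mul_zero]

variable [IsDomain T]

theorem IsPBWBasis.x_pow_mem_center (H : IsPBWBasis q a x y B) (hq : IsPrimitiveRoot q n)
    (hn : 2 ≤ n) : x ^ n ∈ Subalgebra.center T A := by
  refine H.mem_center (Commute.pow_left rfl n) (Eq.symm ?_)
  rw [y_mul_x_pow H.y_mul_x, hq.pow_eq_one, hq.geom_sum_eq_zero hn]
  simp

theorem IsPBWBasis.y_pow_mem_center (H : IsPBWBasis q a x y B) (hq : IsPrimitiveRoot q n)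
    (hn : 2 ≤ n) : y ^ n ∈ Subalgebra.center T A := by
  refine H.mem_center ?_ (Commute.pow_left rfl n)
  rw [commute_iff_eq, y_pow_mul_x H.y_mul_x, hq.pow_eq_one, hq.geom_sum_eq_zero hn]
  simp

/-- The exponents of the monomials of a central element are divisible by `n`: the commutators with
`x` and `y` relate the coefficient at `(i, j)` to the one at `(i + 1, j + 1)`, and the support is
finite. -/
theorem IsPBWBasis.dvd_of_mem_center (H : IsPBWBasis q a x y B) (hq : IsPrimitiveRoot q n)
    (hn : 2 ≤ n) {z : A} (hz : z ∈ Subalgebra.center T A) {i j : ℕ}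
    (hij : B.repr z (i, j) ≠ 0) : n ∣ i ∧ n ∣ j := by
  have hq1 : q - 1 ≠ 0 := sub_ne_zero.2 (hq.ne_one hn)
  obtain ⟨N, hN⟩ : ∃ N, ∀ i j, N ≤ i → B.repr z (i, j) = 0 := by
    refine ⟨(B.repr z).support.sup Prod.fst + 1, fun i j hi ↦ ?_⟩
    by_contra hne
    have := Finset.le_sup (f := Prod.fst) (Finsupp.mem_support_iff.2 hne)
    simp only at this
    omega
  have decay (d : ℕ → ℕ → T) (h0 : ∀ i j, N ≤ i → d i j = 0)
      (hd : ∀ i j, (q - 1) * d i j + a * d (i + 1) (j + 1) = 0) (i j : ℕ) : d i j = 0 := by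
    -- descending induction on the first exponent, starting from the bound `N`
    have key : ∀ k i j, N ≤ i + k → d i j = 0 := by
      intro k
      induction k with
      | zero => exact h0
      | succ k ih =>
        intro i j hi
        have := hd i j
        rw [ih (i + 1) (j + 1) (by omega), mul_zero, add_zero] at this
        exact (mul_eq_zero.1 this).resolve_left hq1
    exact key N i j (by omega)
  have hzc := Subalgebra.mem_center_iff.1 hz
  constructor
  · have := decay (fun i j ↦ (∑ k ∈ Finset.range i, q ^ k) * B.repr z (i, j))
      (fun i j hi ↦ by rw [hN i j hi, mul_zero]) (fun i j ↦ by
        have := H.repr_commutator_y z i j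
        rw [hzc y, sub_self, ← mul_geom_sum] at this
        simp only [map_zero, Finsupp.coe_zero, Pi.zero_apply] at this
        linear_combination -this) i j
    exact hq.dvd_of_geom_sum_eq_zero ((mul_eq_zero.1 this).resolve_right hij)
  · have := decay (fun i j ↦ (∑ k ∈ Finset.range j, q ^ k) * B.repr z (i, j))
      (fun i j hi ↦ by rw [hN i j hi, mul_zero]) (fun i j ↦ by
        have := H.repr_commutator_x z i j
        rw [hzc x, sub_self, ← mul_geom_sum] at this
        simp only [map_zero, Finsupp.coe_zero, Pi.zero_apply] at this
        linear_combination -this) i j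
    exact hq.dvd_of_geom_sum_eq_zero ((mul_eq_zero.1 this).resolve_right hij)

theorem IsPBWBasis.pow_mul_pow_mul (H : IsPBWBasis q a x y B) (hq : IsPrimitiveRoot q n)
    (hn : 2 ≤ n) (s t i j : ℕ) :
    (x ^ n) ^ s * (y ^ n) ^ t * (x ^ i * y ^ j) = B (n * s + i, n * t + j) := by
  have hc := Subalgebra.mem_center_iff.1 (pow_mem (H.y_pow_mem_center hq hn) t) (x ^ i)
  rw [H.basis_apply, pow_add, pow_add, mul_assoc, ← mul_assoc _ (x ^ i), ← hc, ← pow_mul,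
    ← pow_mul]
  simp only [mul_assoc]

/-- The homomorphism from the polynomial ring to the center given by `x ^ n` and `y ^ n`. -/
noncomputable def IsPBWBasis.toCenter (H : IsPBWBasis q a x y B) (hq : IsPrimitiveRoot q n)
    (hn : 2 ≤ n) : MvPolynomial (Fin 2) T →ₐ[T] Subalgebra.center T A :=
  MvPolynomial.aeval ![⟨x ^ n, H.x_pow_mem_center hq hn⟩, ⟨y ^ n, H.y_pow_mem_center hq hn⟩]

theorem IsPBWBasis.toCenter_monomial (H : IsPBWBasis q a x y B) (hq : IsPrimitiveRoot q n)
    (hn : 2 ≤ n) (s : Fin 2 →₀ ℕ) :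
    (H.toCenter hq hn (MvPolynomial.monomial s 1) : A) = B (n * s 0, n * s 1) := by
  have := H.pow_mul_pow_mul hq hn (s 0) (s 1) 0 0
  simp only [pow_zero, mul_one, add_zero] at this
  rw [← this, toCenter, MvPolynomial.aeval_monomial, map_one, one_mul,
    Finsupp.prod_fintype _ _ (by simp)]
  simp [Fin.prod_univ_two]

theorem IsPBWBasis.toCenter_bijective (H : IsPBWBasis q a x y B) (hq : IsPrimitiveRoot q n)
    (hn : 2 ≤ n) : Function.Bijective (H.toCenter hq hn) := by
  have hn0 : n ≠ 0 := by omega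
  constructor
  · let f : MvPolynomial (Fin 2) T →ₗ[T] A :=
      ((Subalgebra.center T A).val.comp (H.toCenter hq hn)).toLinearMap
    suffices Function.Injective f from fun p r h ↦ this (congrArg Subtype.val h)
    have hli : LinearIndependent T (f ∘ MvPolynomial.basisMonomials (Fin 2) T) := by
      have : f ∘ MvPolynomial.basisMonomials (Fin 2) T =
          B ∘ fun s : Fin 2 →₀ ℕ ↦ (n * s 0, n * s 1) := by
        funext s
        simpa [f] using H.toCenter_monomial hq hn s
      rw [this]
      refine B.linearIndependent.comp _ fun s t hst ↦ ?_
      simp only [Prod.mk.injEq, mul_eq_mul_left_iff, hn0, or_false] at hst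
      ext i
      fin_cases i
      exacts [hst.1, hst.2]
    have hf : f = Finsupp.linearCombination T (f ∘ MvPolynomial.basisMonomials (Fin 2) T) ∘ₗ
        (MvPolynomial.basisMonomials (Fin 2) T).repr.toLinearMap :=
      (MvPolynomial.basisMonomials (Fin 2) T).ext fun s ↦ by
        rw [LinearMap.comp_apply, LinearEquiv.coe_coe, Module.Basis.repr_self,
          Finsupp.linearCombination_single, one_smul, Function.comp_apply]
    rw [hf, LinearMap.coe_comp]
    exact Function.Injective.comp hli (LinearEquiv.injective _)
  · rintro ⟨z, hz⟩
    suffices z ∈ ((Subalgebra.center T A).val.comp (H.toCenter hq hn)).range by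
      obtain ⟨p, hp⟩ := this
      exact ⟨p, Subtype.ext hp⟩
    rw [← B.linearCombination_repr z, Finsupp.linearCombination_apply]
    refine Subalgebra.sum_mem _ fun p hp ↦ Subalgebra.smul_mem _ ?_ _
    obtain ⟨⟨s, hs⟩, t, ht⟩ := H.dvd_of_mem_center hq hn hz (Finsupp.mem_support_iff.1 hp)
    refine ⟨MvPolynomial.monomial (Finsupp.equivFunOnFinite.symm ![s, t]) 1, ?_⟩
    have := H.toCenter_monomial hq hn (Finsupp.equivFunOnFinite.symm ![s, t])
    simpa [← hs, ← ht] using this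

/-- The center is the polynomial ring in `x ^ n` and `y ^ n`. -/
noncomputable def IsPBWBasis.centerEquiv (H : IsPBWBasis q a x y B) (hq : IsPrimitiveRoot q n)
    (hn : 2 ≤ n) : MvPolynomial (Fin 2) T ≃ₐ[T] Subalgebra.center T A :=
  AlgEquiv.ofBijective (H.toCenter hq hn) (H.toCenter_bijective hq hn)

theorem IsPBWBasis.centerEquiv_X_zero (H : IsPBWBasis q a x y B) (hq : IsPrimitiveRoot q n)
    (hn : 2 ≤ n) : (H.centerEquiv hq hn (MvPolynomial.X 0) : A) = x ^ n := by
  simp [centerEquiv, toCenter]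

theorem IsPBWBasis.centerEquiv_X_one (H : IsPBWBasis q a x y B) (hq : IsPrimitiveRoot q n)
    (hn : 2 ≤ n) : (H.centerEquiv hq hn (MvPolynomial.X 1) : A) = y ^ n := by
  simp [centerEquiv, toCenter]

/-- The index bijection behind freeness over the center: the exponent pair `(n s + i, n t + j)`
corresponds to the basis element `x ^ i * y ^ j` and the central monomial with exponents
`(s, t)`. -/
noncomputable def exponentEquiv (n : ℕ) [NeZero n] :
    (Σ _ : Fin n × Fin n, Fin 2 →₀ ℕ) ≃ ℕ × ℕ :=
  (Equiv.sigmaEquivProd _ _).trans <| (Equiv.prodComm _ _).trans <|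
    (Equiv.prodCongr (Finsupp.equivFunOnFinite.trans (finTwoArrowEquiv ℕ)) (Equiv.refl _)).trans <|
    (Equiv.prodProdProdComm _ _ _ _).trans <|
    Equiv.prodCongr (Nat.divModEquiv n).symm (Nat.divModEquiv n).symm

theorem exponentEquiv_apply (n : ℕ) [NeZero n] (p : Fin n × Fin n) (s : Fin 2 →₀ ℕ) :
    exponentEquiv n ⟨p, s⟩ = (n * s 0 + p.1, n * s 1 + p.2) := by
  simp [exponentEquiv, Nat.divModEquiv, mul_comm, finTwoArrowEquiv]

theorem IsPBWBasis.exists_centerBasis (H : IsPBWBasis q a x y B) (hq : IsPrimitiveRoot q n)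
    (hn : 2 ≤ n) : ∃ b : Module.Basis (Fin n × Fin n) (Subalgebra.center T A) A,
      ∀ i j : Fin n, b (i, j) = x ^ (i : ℕ) * y ^ (j : ℕ) := by
  have : NeZero n := ⟨by omega⟩
  let v : Fin n × Fin n → A := fun p ↦ x ^ (p.1 : ℕ) * y ^ (p.2 : ℕ)
  let f : (Fin n × Fin n →₀ Subalgebra.center T A) →ₗ[Subalgebra.center T A] A :=
    Finsupp.linearCombination (Subalgebra.center T A) v
  let C : Module.Basis _ T (Fin n × Fin n →₀ Subalgebra.center T A) :=
    Finsupp.basis fun _ ↦ (MvPolynomial.basisMonomials (Fin 2) T).map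
      (H.centerEquiv hq hn).toLinearEquiv
  -- `f` carries the `T`-basis `C` bijectively onto the `T`-basis `B`
  let g := C.equiv B (exponentEquiv n)
  have hfg : f.restrictScalars T = g.toLinearMap := by
    refine C.ext fun ⟨p, s⟩ ↦ ?_
    have h1 := H.toCenter_monomial hq hn s
    rw [H.basis_apply, pow_mul, pow_mul] at h1
    rw [LinearEquiv.coe_coe, Module.Basis.equiv_apply, exponentEquiv_apply,
      ← H.pow_mul_pow_mul hq hn, ← h1]
    simp [C, f, v, centerEquiv]
    rfl
  have hf : Function.Bijective f := by
    have h : ⇑f = ⇑g := congrArg DFunLike.coe hfg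
    rw [h]
    exact g.bijective
  refine ⟨Module.Basis.ofRepr (LinearEquiv.ofBijective f hf).symm, fun i j ↦ ?_⟩
  simp [f, v]

end Center

/-! ### Primitive roots of unity and the `n`-th power of the normal element -/

section RootsOfUnity

theorem IsPBWBasis.normalElt_pow_mem_center {T : Type*} [CommRing T] {A : Type*}
    [Ring A] [Algebra T A] {q a : T} {x y : A} {B : Module.Basis (ℕ × ℕ) T A} {n : ℕ}
    (H : IsPBWBasis q a x y B)
    (hq : IsPrimitiveRoot q n) : normalElt q a x y ^ n ∈ Subalgebra.center T A := by
  refine H.mem_center ?_ ?_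
  · have := pow_mul_pow_of_mul_eq_smul (normalElt_mul_x H.y_mul_x) n 1
    simpa [hq.pow_eq_one, commute_iff_eq] using this
  · have := pow_mul_pow_of_mul_eq_smul (y_mul_normalElt H.y_mul_x) 1 n
    simpa [hq.pow_eq_one, commute_iff_eq] using this.symm

variable {T : Type*} [CommRing T] [IsDomain T] {q a : T} {n : ℕ}

/-- The constant term of `X ^ n - 1 = ∏ (X - q ^ k)`. -/
theorem IsPrimitiveRoot.pow_sum_range_mul_neg_one_pow (hq : IsPrimitiveRoot q n) (hn : 0 < n) :
    q ^ (∑ k ∈ Finset.range n, k) * (-1) ^ n = -1 := by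
  have h := congrArg (Polynomial.eval 0) (X_pow_sub_C_eq_prod hq hn (one_pow n))
  simp only [mul_one, Polynomial.eval_sub, Polynomial.eval_pow, Polynomial.eval_X, map_one,
    Polynomial.eval_one, Polynomial.eval_prod, map_pow, Polynomial.eval_C, zero_pow hn.ne',
    zero_sub, neg_eq_neg_one_mul (q ^ _), Finset.prod_mul_distrib, Finset.prod_const,
    Finset.card_range] at h
  rw [← Finset.prod_pow_eq_pow_sum, mul_comm]
  exact h.symm

theorem IsPrimitiveRoot.natCast_eq_one_sub_pow_mul_prod (hq : IsPrimitiveRoot q n) (hn : 2 ≤ n) :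
    (n : T) = (1 - q) ^ (n - 1) *
      ∏ i ∈ Finset.Icc 2 (n - 1), ∑ j ∈ Finset.range i, q ^ j := by
  obtain ⟨k, rfl⟩ : ∃ k, n = k + 2 := ⟨n - 2, by omega⟩
  have h : Finset.Icc 2 (k + 2 - 1) = Finset.Ico 2 (k + 2) := by ext; simp; omega
  have h1 := hq.prod_one_sub_pow_eq_order
  simp only [← mul_neg_geom_sum, Finset.prod_mul_distrib, Finset.prod_const,
    Finset.card_range] at h1
  rw [Finset.prod_range_succ'] at h1
  rw [h, Finset.prod_Ico_eq_prod_range]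
  simp only [zero_add, Finset.sum_range_one, pow_zero, mul_one] at h1
  push_cast at h1 ⊢
  rw [show (k : T) + 2 = k + 1 + 1 by ring, ← h1]
  refine congrArg _ (Finset.prod_congr rfl fun i _ ↦ ?_)
  rw [show 2 + i = i + 1 + 1 by omega]

variable {A : Type*} [Ring A] [Algebra T A] {x y : A} {B : Module.Basis (ℕ × ℕ) T A}

/-- Being central, the `n`-th power involves only the monomials `1` and `x ^ n * y ^ n`. -/
theorem IsPBWBasis.normalElt_pow_order (H : IsPBWBasis q a x y B) (hq : IsPrimitiveRoot q n)
    (hn : 2 ≤ n) : normalElt q a x y ^ n =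
      -(algebraMap T A ((1 - q) ^ n) * x ^ n * y ^ n - algebraMap T A (a ^ n)) := by
  have hc (l : ℕ) (hl : l ∈ Finset.range (n + 1)) (h0 : l ≠ 0 ∧ l ≠ n) :
      normalCoeff q a n l • (x ^ l * y ^ l) = 0 := by
    have hr : B.repr (normalElt q a x y ^ n) (l, l) = normalCoeff q a n l := by
      have e (m : ℕ) : x ^ m * y ^ m = B (m, m) := (H.basis_apply (m, m)).symm
      simp only [normalElt_pow H.y_mul_x, e, map_sum, map_smul, Finsupp.coe_finsetSum,
        Finset.sum_apply, Finsupp.smul_apply, Module.Basis.repr_self, Finsupp.single_apply,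
        Prod.mk.injEq, and_self, smul_eq_mul, mul_ite, mul_one, mul_zero]
      rw [Finset.sum_ite_eq' _ l, if_pos hl]
    by_cases hz : normalCoeff q a n l = 0
    · rw [hz, zero_smul]
    · have hd := (H.dvd_of_mem_center hq hn (H.normalElt_pow_mem_center hq) (hr ▸ hz)).1
      have := Nat.le_of_dvd (by omega) hd
      have := Finset.mem_range.1 hl
      omega
  have hu : q ^ (∑ k ∈ Finset.range n, k) * (q - 1) ^ n = -(1 - q) ^ n := by
    rw [← neg_sub 1 q, neg_pow, ← mul_assoc, hq.pow_sum_range_mul_neg_one_pow (by omega),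
      neg_one_mul]
  rw [normalElt_pow H.y_mul_x, Finset.sum_eq_add_of_mem 0 n (by simp) (by simp) (by omega) hc,
    normalCoeff_zero_right, normalCoeff_self, hu, pow_zero, pow_zero, mul_one, neg_smul,
    Algebra.smul_def, Algebra.smul_def, mul_one, mul_assoc]
  abel

end RootsOfUnity

/-! ### The left trace and Gram matrices -/

section Trace

variable {Z : Type*} {A : Type*} [CommRing Z] [Ring A] [Algebra Z A]

theorem leftTrace_eq_comp (s : A) :
    leftTrace Z s = (LinearMap.trace Z A ∘ₗ LinearMap.mul Z A) s := rfl

theorem leftTrace_smul (c : Z) (s : A) : leftTrace Z (c • s) = c * leftTrace Z s := by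
  rw [leftTrace_eq_comp, map_smul, ← leftTrace_eq_comp, smul_eq_mul]

theorem leftTrace_mul_comm (s t : A) : leftTrace Z (s * t) = leftTrace Z (t * s) := by
  rw [leftTrace, leftTrace, LinearMap.mulLeft_mul, LinearMap.mulLeft_mul]
  exact LinearMap.trace_mul_comm Z _ _

theorem leftTrace_one [Nontrivial Z] {ι : Type*} [Fintype ι] (b : Module.Basis ι Z A) :
    leftTrace Z (1 : A) = Fintype.card ι := by
  have := Module.Free.of_basis b
  have := Module.Finite.of_basis b
  rw [leftTrace, LinearMap.mulLeft_one, ← Module.finrank_eq_card_basis b]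
  exact LinearMap.trace_one Z A

/-- The Gram matrix of a family of elements for the trace form `(s, t) ↦ tr (s t)`. -/
noncomputable def gramMatrix (Z : Type*) {A : Type*} [CommRing Z] [Ring A] [Algebra Z A]
    {ι : Type*} (v : ι → A) : Matrix ι ι Z :=
  Matrix.of fun i j ↦ leftTrace Z (v i * v j)

theorem gramMatrix_sum_smul {ι κ : Type*} [Fintype ι] (P : Matrix κ ι Z) (v : ι → A) :
    gramMatrix Z (fun k ↦ ∑ i, P k i • v i) = P * gramMatrix Z v * P.transpose := by
  ext k l
  simp only [gramMatrix, Matrix.of_apply, Matrix.mul_apply, Matrix.transpose_apply,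
    leftTrace_eq_comp, Finset.sum_mul, Finset.mul_sum, smul_mul_assoc, mul_smul_comm, map_sum,
    map_smul, smul_eq_mul]
  refine Finset.sum_congr rfl fun i _ ↦ Finset.sum_congr rfl fun j _ ↦ ?_
  ring

theorem det_gramMatrix_sum_smul {ι : Type*} [Fintype ι] [DecidableEq ι] (P : Matrix ι ι Z)
    (v : ι → A) :
    (gramMatrix Z (fun k ↦ ∑ i, P k i • v i)).det = P.det ^ 2 * (gramMatrix Z v).det := by
  rw [gramMatrix_sum_smul, Matrix.det_mul, Matrix.det_mul, Matrix.det_transpose]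
  ring

theorem Matrix.det_of_ite_eq_perm {ι : Type*} [Fintype ι] [DecidableEq ι] (σ : Equiv.Perm ι)
    (d : ι → Z) :
    (Matrix.of fun i j ↦ if j = σ i then d i else 0).det = ((σ.sign : ℤ) : Z) * ∏ i, d i := by
  have : (Matrix.of fun i j ↦ if j = σ i then d i else 0) =
      Matrix.diagonal d * σ.permMatrix Z := by
    ext i j
    simp [Matrix.diagonal_mul, PEquiv.toMatrix_apply, eq_comm]
  rw [this, Matrix.det_mul, Matrix.det_diagonal, Matrix.det_permutation, mul_comm]

end Trace

/-! ### Carries in addition modulo `n` -/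

section FinSums

variable {n : ℕ}

/-- The number of carries when adding `l` to all residues, by comparing `i + l` with its remainder
modulo `n`. -/
theorem Fin.sum_add_val_div (l : Fin n) : ∑ i : Fin n, ((i : ℕ) + l) / n = l := by
  have : NeZero n := ⟨fun h ↦ (h ▸ l).elim0⟩
  have h1 : ∑ i : Fin n, ((i + l : Fin n) : ℕ) = ∑ i : Fin n, (i : ℕ) :=
    Equiv.sum_comp (Equiv.addRight l) (fun i : Fin n ↦ (i : ℕ))
  have h2 : ∑ i : Fin n, (n * (((i : ℕ) + l) / n) + ((i + l : Fin n) : ℕ)) =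
      ∑ i : Fin n, ((i : ℕ) + l) :=
    Finset.sum_congr rfl fun i _ ↦ by rw [Fin.val_add, Nat.div_add_mod]
  rw [Finset.sum_add_distrib, Finset.sum_add_distrib, h1, ← Finset.mul_sum, Finset.sum_const,
    Finset.card_univ, Fintype.card_fin, smul_eq_mul, add_comm, add_right_inj] at h2
  exact Nat.eq_of_mul_eq_mul_left n.pos_of_neZero h2

theorem Fin.sum_val_mul_two (n : ℕ) : (∑ i : Fin n, (i : ℕ)) * 2 = n * (n - 1) := by
  rw [Fin.sum_univ_eq_sum_range (fun i ↦ i), Finset.sum_range_id_mul_two]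

theorem Fin.dvd_val_add_iff [NeZero n] (i k : Fin n) : n ∣ (i : ℕ) + k ↔ k = -i := by
  rw [Nat.dvd_iff_mod_eq_zero, ← Fin.val_add, ← Fin.val_zero n, Fin.val_inj, add_comm,
    add_eq_zero_iff_eq_neg]

theorem Fin.sum_add_neg_val_div [NeZero n] :
    ∑ i : Fin n, ((i : ℕ) + (-i : Fin n)) / n = n - 1 := by
  have h1 : ∑ i : Fin n, ((-i : Fin n) : ℕ) = ∑ i : Fin n, (i : ℕ) :=
    Equiv.sum_comp (Equiv.neg (Fin n)) (fun i : Fin n ↦ (i : ℕ))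
  have h2 : ∑ i : Fin n, (n * (((i : ℕ) + (-i : Fin n)) / n)) =
      ∑ i : Fin n, ((i : ℕ) + (-i : Fin n)) :=
    Finset.sum_congr rfl fun i _ ↦ Nat.mul_div_cancel' ((Fin.dvd_val_add_iff i (-i)).2 rfl)
  rw [Finset.sum_add_distrib, h1, ← Finset.mul_sum, ← mul_two, Fin.sum_val_mul_two] at h2
  exact Nat.eq_of_mul_eq_mul_left n.pos_of_neZero h2

end FinSums

/-! ### Gram determinants of monomials -/

section Discriminant

variable {T : Type*} [CommRing T] {A : Type*} [Ring A] [Algebra T A] {q a : T}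
  {x y : A} {n : ℕ} {Z : Type*} [CommRing Z] [Algebra T Z] [Algebra Z A]
  [IsScalarTower T Z A]

/-- A monomial `x ^ i * w ^ j` whose exponents are not both divisible by `n` is traceless: up to a
central factor it is a commutator of `w` or of `x` with another such monomial. -/
theorem leftTrace_pow_mul_normalElt_pow [IsDomain Z] (h : y * x = q • (x * y) + algebraMap T A a)
    (hq : IsPrimitiveRoot q n) (hn : 2 ≤ n) (hinj : Function.Injective (algebraMap T Z))
    {X W : Z} (hX : algebraMap Z A X = x ^ n) (hW : algebraMap Z A W = normalElt q a x y ^ n)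
    (hX0 : X ≠ 0) (hW0 : W ≠ 0) (b : Module.Basis (Fin n × Fin n) Z A) (i j : ℕ) :
    leftTrace Z (x ^ i * normalElt q a x y ^ j) =
      if n ∣ i ∧ n ∣ j then (n : Z) ^ 2 * X ^ (i / n) * W ^ (j / n) else 0 := by
  set w : A := normalElt q a x y with hw
  have hwx : w * x = q • (x * w) := normalElt_mul_x h
  have smulT (c : T) (s : A) : leftTrace Z (c • s) = algebraMap T Z c * leftTrace Z s := by
    rw [← leftTrace_smul, algebraMap_smul]
  have vanish {k : ℕ} (hk : ¬ n ∣ k) {t : Z} (ht : t = algebraMap T Z (q ^ k) * t) : t = 0 := by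
    have h0 : (algebraMap T Z (q ^ k) - 1) * t = 0 := by linear_combination -ht
    refine (mul_eq_zero.1 h0).resolve_left fun h1 ↦ hk (hq.dvd_of_pow_eq_one k (hinj ?_))
    rw [map_one]
    exact sub_eq_zero.1 h1
  by_cases hi : n ∣ i
  · by_cases hj : n ∣ j
    · obtain ⟨s, rfl⟩ := hi
      obtain ⟨t, rfl⟩ := hj
      have e : x ^ (n * s) * w ^ (n * t) = (X ^ s * W ^ t) • (1 : A) := by
        rw [Algebra.smul_def, map_mul, map_pow, map_pow, hX, hW, mul_one, pow_mul, pow_mul]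
      rw [if_pos ⟨dvd_mul_right _ _, dvd_mul_right _ _⟩, e, leftTrace_smul, leftTrace_one b,
        Nat.mul_div_cancel_left _ (by omega), Nat.mul_div_cancel_left _ (by omega)]
      simp only [Fintype.card_prod, Fintype.card_fin, Nat.cast_mul]
      ring
    · rw [if_neg fun h ↦ hj h.2]
      refine (mul_eq_zero.1 (?_ : X * leftTrace Z (x ^ i * w ^ j) = 0)).resolve_left hX0
      have e : X * leftTrace Z (x ^ i * w ^ j) =
          leftTrace Z (x * (x ^ (n - 1 + i) * w ^ j)) := by
        rw [← leftTrace_smul, Algebra.smul_def, hX, ← mul_assoc, ← mul_assoc, ← pow_succ',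
          ← pow_add]
        congr 3; omega
      have c := pow_mul_pow_of_mul_eq_smul hwx j 1
      rw [pow_one, mul_one] at c
      refine vanish hj ?_
      nth_rw 1 [e]
      rw [leftTrace_mul_comm, mul_assoc, c, mul_smul_comm, smulT, e, ← mul_assoc, ← mul_assoc,
        ← pow_succ, ← pow_succ']
  · rw [if_neg fun h ↦ hi h.1]
    refine (mul_eq_zero.1 (?_ : W * leftTrace Z (x ^ i * w ^ j) = 0)).resolve_left hW0
    have e : W * leftTrace Z (x ^ i * w ^ j) =
        leftTrace Z (x ^ i * w ^ (n - 1 + j) * w) := by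
      rw [← leftTrace_smul, Algebra.smul_def, Algebra.commutes, hW, mul_assoc, mul_assoc,
        ← pow_succ, ← pow_add]
      congr 3; omega
    have c := pow_mul_pow_of_mul_eq_smul hwx 1 i
    rw [pow_one, one_mul] at c
    refine vanish hi ?_
    nth_rw 1 [e]
    rw [leftTrace_mul_comm, ← mul_assoc, c, smul_mul_assoc, smulT, e, mul_assoc, mul_assoc,
      ← pow_succ, ← pow_succ']

/-- The Gram matrix of the family `x ^ i * w ^ j`, where `w` is the normal element, is supported on
the permutation `(i, j) ↦ (-i, -j)`. -/
theorem det_gramMatrix_normal [IsDomain Z] (h : y * x = q • (x * y) + algebraMap T A a)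
    (hq : IsPrimitiveRoot q n) (hn : 2 ≤ n) (hinj : Function.Injective (algebraMap T Z))
    {X W : Z} (hX : algebraMap Z A X = x ^ n) (hW : algebraMap Z A W = normalElt q a x y ^ n)
    (hX0 : X ≠ 0) (hW0 : W ≠ 0) (b : Module.Basis (Fin n × Fin n) Z A) :
    ∃ u : Tˣ, (gramMatrix Z fun p : Fin n × Fin n ↦
        x ^ (p.1 : ℕ) * normalElt q a x y ^ (p.2 : ℕ)).det =
      algebraMap T Z u * ((n : Z) ^ 2) ^ (n ^ 2) * X ^ (n * (n - 1)) * W ^ (n * (n - 1)) := by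
  have : NeZero n := ⟨by omega⟩
  set w : A := normalElt q a x y with hw
  have hwx : w * x = q • (x * w) := normalElt_mul_x h
  let d : Fin n × Fin n → Z := fun p ↦
    algebraMap T Z q ^ ((p.2 : ℕ) * (-p.1 : Fin n)) * (n : Z) ^ 2 *
      X ^ (((p.1 : ℕ) + (-p.1 : Fin n)) / n) * W ^ (((p.2 : ℕ) + (-p.2 : Fin n)) / n)
  have hG : (gramMatrix Z fun p : Fin n × Fin n ↦ x ^ (p.1 : ℕ) * w ^ (p.2 : ℕ)) =
      Matrix.of fun p r ↦ if r = Equiv.neg (Fin n × Fin n) p then d p else 0 := by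
    ext ⟨i, j⟩ ⟨k, l⟩
    have e : x ^ (i : ℕ) * w ^ (j : ℕ) * (x ^ (k : ℕ) * w ^ (l : ℕ)) =
        (algebraMap T Z q ^ ((j : ℕ) * k)) • (x ^ ((i : ℕ) + k) * w ^ ((j : ℕ) + l)) := by
      rw [← map_pow, algebraMap_smul, mul_assoc, ← mul_assoc (w ^ (j : ℕ)),
        pow_mul_pow_of_mul_eq_smul hwx, smul_mul_assoc, mul_smul_comm, pow_add, pow_add]
      simp only [mul_assoc]
    have t := leftTrace_pow_mul_normalElt_pow h hq hn hinj hX hW hX0 hW0 b (i + k) (j + l)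
    simp only [Fin.dvd_val_add_iff] at t
    simp only [gramMatrix, Matrix.of_apply, e, leftTrace_smul, Equiv.neg_apply, Prod.neg_mk,
      Prod.mk.injEq, d]
    rw [t]
    by_cases hkl : k = -i ∧ l = -j
    · rw [if_pos hkl, if_pos hkl, hkl.1, hkl.2]
      ring
    · rw [if_neg hkl, if_neg hkl, mul_zero]
  have hq1 : IsUnit q := hq.isUnit (by omega)
  let E : ℕ := ∑ p : Fin n × Fin n, (p.2 : ℕ) * (-p.1 : Fin n)
  refine ⟨Units.map (Int.castRingHom T).toMonoidHom (Equiv.neg (Fin n × Fin n)).sign *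
    hq1.unit ^ E, ?_⟩
  have hXE : ∑ p : Fin n × Fin n, ((p.1 : ℕ) + (-p.1 : Fin n)) / n = n * (n - 1) := by
    rw [Fintype.sum_prod_type_right]
    simp [Fin.sum_add_neg_val_div]
  have hWE : ∑ p : Fin n × Fin n, ((p.2 : ℕ) + (-p.2 : Fin n)) / n = n * (n - 1) := by
    rw [Fintype.sum_prod_type]
    simp [Fin.sum_add_neg_val_div]
  rw [hG, Matrix.det_of_ite_eq_perm]
  simp only [d, Finset.prod_mul_distrib, Finset.prod_pow_eq_pow_sum, hXE, hWE]
  simp [E]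
  ring

/-- The determinant of the Gram matrix of `x ^ i * w ^ j` in terms of that of `x ^ i * y ^ j`. The
transition matrix is the product of a block matrix expressing `x ^ i * w ^ j` by the
`x ^ i * x ^ l * y ^ l`, which is triangular, and a monomial matrix. -/
theorem det_gramMatrix_normal_eq (h : y * x = q • (x * y) + algebraMap T A a)
    (hq : IsPrimitiveRoot q n) (hn : 2 ≤ n) {X : Z} (hX : algebraMap Z A X = x ^ n)
    {b : Fin n × Fin n → A} (hb : ∀ i j, b (i, j) = x ^ (i : ℕ) * y ^ (j : ℕ)) :
    ∃ u : Tˣ, (gramMatrix Z fun p : Fin n × Fin n ↦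
        x ^ (p.1 : ℕ) * normalElt q a x y ^ (p.2 : ℕ)).det =
      algebraMap T Z u * algebraMap T Z ((1 - q) ^ ((n - 1) * n ^ 2)) * X ^ (n * (n - 1)) *
        (gramMatrix Z b).det := by
  have : NeZero n := ⟨by omega⟩
  let C : Matrix (Fin n) (Fin n) Z := Matrix.of fun j l ↦ algebraMap T Z (normalCoeff q a j l)
  let σ : Equiv.Perm (Fin n × Fin n) :=
    { toFun := fun p ↦ (p.1 + p.2, p.2)
      invFun := fun p ↦ (p.1 - p.2, p.2)
      left_inv := fun p ↦ by simp
      right_inv := fun p ↦ by simp }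
  let D : Matrix (Fin n × Fin n) (Fin n × Fin n) Z :=
    Matrix.of fun p r ↦ if r = σ p then X ^ (((p.1 : ℕ) + p.2) / n) else 0
  let K : Matrix (Fin n × Fin n) (Fin n × Fin n) Z :=
    Matrix.kronecker (1 : Matrix (Fin n) (Fin n) Z) C
  have hD : (fun p : Fin n × Fin n ↦ x ^ ((p.1 : ℕ) + p.2) * y ^ (p.2 : ℕ)) =
      fun p ↦ ∑ r, D p r • b r := by
    funext ⟨i, l⟩
    simp only [D, Matrix.of_apply, ite_smul, zero_smul, Finset.sum_ite_eq', Finset.mem_univ,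
      if_true, σ, Equiv.coe_fn_mk, hb, Fin.val_add]
    rw [Algebra.smul_def, map_pow, hX, ← pow_mul, ← mul_assoc, ← pow_add, Nat.div_add_mod]
  have hK : (fun p : Fin n × Fin n ↦ x ^ (p.1 : ℕ) * normalElt q a x y ^ (p.2 : ℕ)) =
      fun p ↦ ∑ r, K p r • (x ^ ((r.1 : ℕ) + r.2) * y ^ (r.2 : ℕ)) := by
    funext ⟨i, j⟩
    have hext : ∑ l ∈ Finset.range (j + 1), normalCoeff q a j l • (x ^ l * y ^ l) =
        ∑ l ∈ Finset.range n, normalCoeff q a j l • (x ^ l * y ^ l) := by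
      refine Finset.sum_subset (Finset.range_mono j.2) fun l _ hl ↦ ?_
      rw [normalCoeff_of_lt q a (by simpa using hl), zero_smul]
    rw [normalElt_pow h, hext, ← Fin.sum_univ_eq_sum_range
      (fun l ↦ normalCoeff q a j l • (x ^ l * y ^ l)), Finset.mul_sum, Fintype.sum_prod_type]
    refine (Eq.trans (Finset.sum_eq_single i ?_ (by simp)) ?_).symm
    · intro k _ hk
      refine Finset.sum_eq_zero fun l _ ↦ ?_
      simp [K, Matrix.kroneckerMap_apply, Matrix.one_apply_ne hk.symm]
    · refine Finset.sum_congr rfl fun l _ ↦ ?_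
      simp [K, C, Matrix.kroneckerMap_apply, pow_add, mul_assoc]
  have hdetC : C.det = algebraMap T Z (∏ j : Fin n, q ^ (∑ k ∈ Finset.range j, k)) *
      algebraMap T Z (q - 1) ^ (∑ j : Fin n, (j : ℕ)) := by
    rw [Matrix.det_of_isLowerTriangular]
    · simp only [C, Matrix.of_apply, normalCoeff_self, map_mul, Finset.prod_mul_distrib,
        map_pow, Finset.prod_pow_eq_pow_sum]
    · intro i j hij
      simp only [C, Matrix.of_apply, normalCoeff_of_lt q a (show (i : ℕ) < j from hij), map_zero]
  have hdetD : D.det ^ 2 = X ^ (n * (n - 1)) := by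
    have hs : ((σ.sign : ℤ) : Z) ^ 2 = 1 := by
      rcases Int.units_eq_one_or σ.sign with h | h <;> simp [h]
    rw [Matrix.det_of_ite_eq_perm, mul_pow, hs, one_mul, Finset.prod_pow_eq_pow_sum, ← pow_mul,
      Fintype.sum_prod_type_right]
    simp only [Fin.sum_add_val_div, Fin.sum_val_mul_two]
  have hdetK : K.det = C.det ^ n := by
    refine (Matrix.det_kronecker _ _).trans ?_
    rw [Matrix.det_one, one_pow, one_mul, Fintype.card_fin]
  have hq1 : IsUnit (∏ j : Fin n, q ^ (∑ k ∈ Finset.range j, k)) := by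
    rw [Finset.prod_pow_eq_pow_sum]
    exact (hq.isUnit (by omega)).pow _
  refine ⟨hq1.unit ^ (n * 2), ?_⟩
  have hpow : (algebraMap T Z (q - 1) ^ (∑ j : Fin n, (j : ℕ))) ^ (n * 2) =
      algebraMap T Z ((1 - q) ^ ((n - 1) * n ^ 2)) := by
    rw [← pow_mul, ← mul_assoc, mul_right_comm, Fin.sum_val_mul_two, ← map_pow, ← neg_sub 1 q,
      Even.neg_pow ((Nat.even_mul_pred_self n).mul_right n)]
    congr 2; ring
  rw [hK, det_gramMatrix_sum_smul, hD, det_gramMatrix_sum_smul, hdetD, hdetK, ← pow_mul, hdetC,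
    mul_pow, hpow, Units.val_pow_eq_pow_val, IsUnit.unit_spec, map_pow _ (∏ j : Fin n, _)]
  ring

/-- The discriminant in the basis `x ^ i * y ^ j`. It is obtained by cancelling
`(1 - q) ^ ((n - 1) n ^ 2) X ^ (n (n - 1))` between the two evaluations of the Gram determinant of
the `x ^ i * w ^ j`; the identity `n = (1 - q) ^ (n - 1) m` turns `n ^ (2 n ^ 2)` into
`(n m) ^ (n ^ 2)` times the power of `1 - q`. -/
theorem det_gramMatrix_monomials [IsDomain T] [IsDomain Z]
    (h : y * x = q • (x * y) + algebraMap T A a)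
    (hq : IsPrimitiveRoot q n) (hn : 2 ≤ n) (hinj : Function.Injective (algebraMap T Z))
    {X W : Z} (hX : algebraMap Z A X = x ^ n) (hW : algebraMap Z A W = normalElt q a x y ^ n)
    (hX0 : X ≠ 0) (hW0 : W ≠ 0) {b : Module.Basis (Fin n × Fin n) Z A}
    (hb : ∀ i j, b (i, j) = x ^ (i : ℕ) * y ^ (j : ℕ)) :
    ∃ u : Tˣ, (gramMatrix Z b).det = algebraMap T Z u * algebraMap T Z
      (((n : T) * ∏ i ∈ Finset.Icc 2 (n - 1), ∑ j ∈ Finset.range i, q ^ j) ^ (n ^ 2)) *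
        W ^ (n * (n - 1)) := by
  obtain ⟨u₁, h₁⟩ := det_gramMatrix_normal h hq hn hinj hX hW hX0 hW0 b
  obtain ⟨u₂, h₂⟩ := det_gramMatrix_normal_eq (Z := Z) (b := b) h hq hn hX hb
  refine ⟨u₂⁻¹ * u₁, ?_⟩
  set m := ∏ i ∈ Finset.Icc 2 (n - 1), ∑ j ∈ Finset.range i, q ^ j
  have hne : algebraMap T Z ((1 - q) ^ ((n - 1) * n ^ 2)) * X ^ (n * (n - 1)) ≠ 0 := by
    refine mul_ne_zero ?_ (pow_ne_zero _ hX0)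
    rw [map_ne_zero_iff _ hinj]
    exact pow_ne_zero _ (sub_ne_zero.2 (hq.ne_one hn).symm)
  have hu : algebraMap T Z ((u₂⁻¹ : Tˣ) : T) * algebraMap T Z u₂ = 1 := by
    rw [← map_mul, Units.inv_mul, map_one]
  have hsplit : ((n : Z) ^ 2) ^ (n ^ 2) = algebraMap T Z ((1 - q) ^ ((n - 1) * n ^ 2)) *
      algebraMap T Z (((n : T) * m) ^ (n ^ 2)) := by
    have hT : (n : T) ^ 2 = (1 - q) ^ (n - 1) * (n * m) := by
      linear_combination (n : T) * hq.natCast_eq_one_sub_pow_mul_prod hn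
    rw [← map_mul, pow_mul, ← mul_pow, ← hT, map_pow, map_pow, map_natCast]
  refine mul_left_cancel₀ hne ?_
  rw [h₁, hsplit] at h₂
  rw [Units.val_mul, map_mul]
  linear_combination -(algebraMap T Z ((u₂⁻¹ : Tˣ) : T)) * h₂ -
    (algebraMap T Z ((1 - q) ^ ((n - 1) * n ^ 2)) * X ^ (n * (n - 1)) *
      (gramMatrix Z b).det) * hu

/-- Gram determinants of two bases differ by the square of a unit. -/
theorem exists_unit_basisDiscr_eq [Nontrivial Z] {ι κ : Type*} [Fintype ι] [DecidableEq ι]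
    [Fintype κ] [DecidableEq κ] (b : Module.Basis κ Z A) (z : Module.Basis ι Z A) :
    ∃ u : Zˣ, basisDiscr Z A z = u * (gramMatrix Z b).det := by
  have e : κ ≃ ι := b.indexEquiv z
  let b' : Module.Basis ι Z A := b.reindex e
  let P : Matrix ι ι Z := (b'.toMatrix z).transpose
  have hz : ⇑z = fun k ↦ ∑ i, P k i • b' i := by
    funext k
    exact (b'.sum_toMatrix_smul_self z k).symm
  have hb' : gramMatrix Z b' = (gramMatrix Z b).submatrix e.symm e.symm := by
    ext i j
    simp [gramMatrix, b']
  have hP : IsUnit P.det := by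
    rw [Matrix.det_transpose]
    refine IsUnit.of_mul_eq_one (z.toMatrix b').det ?_
    rw [← Matrix.det_mul, b'.toMatrix_mul_toMatrix_flip, Matrix.det_one]
  have hz' : basisDiscr Z A z = (gramMatrix Z z).det := rfl
  refine ⟨hP.unit ^ 2, ?_⟩
  rw [hz', hz, det_gramMatrix_sum_smul, hb', Matrix.det_submatrix_equiv_self,
    Units.val_pow_eq_pow_val, IsUnit.unit_spec]

end Discriminant

/-! ### The discriminant over the center -/

section CenterDiscriminant

variable {T : Type*} [CommRing T] [IsDomain T] {A : Type*} [Ring A] [Algebra T A] {q a : T}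
  {x y : A} {B : Module.Basis (ℕ × ℕ) T A} {n : ℕ}

theorem IsPBWBasis.normalElt_pow_ne_zero (H : IsPBWBasis q a x y B) (hq : IsPrimitiveRoot q n)
    (hn : 2 ≤ n) : normalElt q a x y ^ n ≠ 0 := by
  intro h
  have e : normalElt q a x y ^ n = -((1 - q) ^ n • B (n, n) - a ^ n • B (0, 0)) := by
    rw [H.normalElt_pow_order hq hn, H.basis_apply, H.basis_apply, Algebra.smul_def,
      Algebra.smul_def]
    simp [mul_assoc]
  have h1 := congrArg (fun s ↦ B.repr s (n, n)) (e.symm.trans h)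
  have hn0 : n ≠ 0 := by omega
  have hq1 : 1 - q ≠ 0 := sub_ne_zero.2 (hq.ne_one hn).symm
  simp [hn0, hq1] at h1

theorem IsPBWBasis.basisDiscr_center (H : IsPBWBasis q a x y B) (hq : IsPrimitiveRoot q n)
    (hn : 2 ≤ n) {ι : Type*} [Fintype ι] [DecidableEq ι]
    (z : Module.Basis ι (Subalgebra.center T A) A) :
    ∃ c : Tˣ, (basisDiscr (Subalgebra.center T A) A z : A) =
      algebraMap T A (c : T) *
        algebraMap T A
          (((n : T) * ∏ i ∈ Finset.Icc 2 (n - 1), ∑ j ∈ Finset.range i, q ^ j) ^ (n ^ 2)) *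
        (algebraMap T A ((1 - q) ^ n) * x ^ n * y ^ n - algebraMap T A (a ^ n)) ^
          (n * (n - 1)) := by
  let e := H.centerEquiv hq hn
  have : IsDomain (Subalgebra.center T A) := e.symm.toMulEquiv.isDomain _
  have : IsScalarTower T (Subalgebra.center T A) A := IsScalarTower.of_algebraMap_eq fun _ ↦ rfl
  have hinj : Function.Injective (algebraMap T (Subalgebra.center T A)) := by
    intro s t hst
    refine MvPolynomial.C_injective (Fin 2) T (e.injective ?_)
    rw [← MvPolynomial.algebraMap_eq, e.commutes, e.commutes, hst]
  let X : Subalgebra.center T A := ⟨x ^ n, H.x_pow_mem_center hq hn⟩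
  let W : Subalgebra.center T A := ⟨normalElt q a x y ^ n, H.normalElt_pow_mem_center hq⟩
  have hX0 : X ≠ 0 := by
    have hX : X = e (MvPolynomial.X 0) := Subtype.ext (H.centerEquiv_X_zero hq hn).symm
    rw [hX, Ne, EmbeddingLike.map_eq_zero_iff]
    exact MvPolynomial.X_ne_zero 0
  have hW0 : W ≠ 0 := fun h ↦ H.normalElt_pow_ne_zero hq hn (congrArg Subtype.val h)
  obtain ⟨b, hb⟩ := H.exists_centerBasis hq hn
  obtain ⟨c, hc⟩ := det_gramMatrix_monomials H.y_mul_x hq hn hinj (X := X) (W := W) rfl rfl hX0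
    hW0 hb
  obtain ⟨v, hv⟩ := exists_unit_basisDiscr_eq b z
  -- units of the polynomial ring `T[x ^ n, y ^ n]` are constant
  obtain ⟨r, hr, hvr⟩ := MvPolynomial.isUnit_iff_eq_C_of_isReduced.1 (v.isUnit.map e.symm)
  have hvr' : (v : Subalgebra.center T A) = algebraMap T _ r := by
    rw [← e.commutes, MvPolynomial.algebraMap_eq, ← hvr, e.apply_symm_apply]
  have hWpow : (W : A) ^ (n * (n - 1)) =
      (algebraMap T A ((1 - q) ^ n) * x ^ n * y ^ n - algebraMap T A (a ^ n)) ^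
        (n * (n - 1)) := by
    rw [show (W : A) = _ from H.normalElt_pow_order hq hn,
      Even.neg_pow (Nat.even_mul_pred_self n)]
  refine ⟨hr.unit * c, ?_⟩
  rw [hv, hc, hvr', ← hWpow, Units.val_mul, IsUnit.unit_spec, map_mul (algebraMap T A) r]
  simp only [mul_assoc]
  rfl

end CenterDiscriminant

theorem QWeyl.isPBWBasis {T : Type*} [CommRing T] (q a : T) :
    IsPBWBasis q a (QWeyl.x q a) (QWeyl.y q a) (QWeyl.pbwBasis q a) :=
  ⟨QWeyl.y_mul_x q a, QWeyl.pbwBasis_apply q a⟩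

theorem theorem2p4 {T : Type u} [CommRing T] [IsDomain T] (n : ℕ) (hn : 2 ≤ n)
    (q : T) (hq : IsPrimitiveRoot q n) (a : T) :
    -- the center is the polynomial ring `T[x ^ n, y ^ n]`
    (∃ e : MvPolynomial (Fin 2) T ≃ₐ[T] QWeyl.center q a,
      (e (MvPolynomial.X 0) : QWeyl T q a) = QWeyl.x q a ^ n ∧
      (e (MvPolynomial.X 1) : QWeyl T q a) = QWeyl.y q a ^ n) ∧
    -- the algebra is free over its center, with basis the `x ^ i * y ^ j`, `0 ≤ i, j ≤ n - 1`
    (∃ b : Module.Basis (Fin n × Fin n) (QWeyl.center q a) (QWeyl T q a),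
      ∀ i j : Fin n, b (i, j) = QWeyl.x q a ^ (i : ℕ) * QWeyl.y q a ^ (j : ℕ)) ∧
    -- the discriminant, computed in any basis over the center, up to a unit of `T`
    (∀ (ι : Type w) [Fintype ι] [DecidableEq ι]
        (z : Module.Basis ι (QWeyl.center q a) (QWeyl T q a)),
      ∃ c : Tˣ, (basisDiscr (QWeyl.center q a) (QWeyl T q a) z : QWeyl T q a) =
        algebraMap T (QWeyl T q a) (c : T) *
          algebraMap T (QWeyl T q a)
            (((n : T) * ∏ i ∈ Finset.Icc 2 (n - 1), ∑ j ∈ Finset.range i, q ^ j) ^ (n ^ 2)) *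
          (algebraMap T (QWeyl T q a) ((1 - q) ^ n) * QWeyl.x q a ^ n * QWeyl.y q a ^ n -
            algebraMap T (QWeyl T q a) (a ^ n)) ^ (n * (n - 1))) := by
  have H := QWeyl.isPBWBasis q a
  exact ⟨⟨H.centerEquiv hq hn, H.centerEquiv_X_zero hq hn, H.centerEquiv_X_one hq hn⟩,
    H.exists_centerBasis hq hn, fun _ _ _ z ↦ H.basisDiscr_center hq hn z⟩
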